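/- **Setting.** Let $G=(V,E,\mathbf b)$ be a connected power network: $(V,E)$ is a finite connected simple undirected graph with $n=|V|\ge 1$ and $m=|E|$, every line (edge) $\ell\in E$ has a susceptance $b_\ell>0$, and every line is given an arbitrary orientation. Let $B=\mathrm{diag}(b_\ell)_{\ell\in E}$, let $C\in\{-1,0,1\}^{n\times m}$ be the incidence matrix ($C_{i\ell}=1$ if $i$ is the source of $\ell$, $-1$ if $i$ is its target, $0$ otherwise), let $L=CBC^T$ be the weighted Laplacian matrix, and let $L^\dagger$ be its Moore–Penrose pseudo-inverse. The effective resistance is $R_{ij}=(\mathbf e_i-\mathbf e_j)^TL^\dagger(\mathbf e_i-\mathbf e_j)$. For a balanced injection vector $\mathbf p\in\mathrm{im}(L)$, the line flow $\mathbf f\in\mathbb R^m$ is the unique solution of the DC power flow equations $\mathbf p=C\mathbf f$, $\mathbf f=BC^T\boldsymbol\theta$ for some $\boldsymbol\theta\in\mathbb R^n$. For $s,t\in V$ with $s\ne t$ and $\delta_{st}\neq 0$, let $\tilde{\mathbf f}$ be the line flow for the injections $\tilde{\mathbf p}=\mathbf p+\delta_{st}(\mathbf e_s-\mathbf e_t)$;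 the power transfer distribution factor is $D_{\ell,st}=(\tilde f_\ell-f_\ell)/\delta_{st}$, and $D_{\ell,st}=0$ if $s=t$. The PTDF matrix is $D=(D_{\ell\hat\ell})_{\ell,\hat\ell\in E}$ with $D_{\ell\hat\ell}=D_{\ell,st}$, where $s$ is the source and $t$ the target of $\hat\ell$. For $\mathcal E\subseteq E$ put $\beta(\mathcal E)=\prod_{\ell\in\mathcal E}b_\ell$, except that $\beta(\emptyset)=0$ if $E\ne\emptyset$. Let $T$ be the set of (edge sets of) spanning trees of $G$, and $T\setminus\{\ell\}$ the set of those that do not contain the line $\ell$. **Proposition.** For every balanced $\mathbf p$ and all nonzero injection changes $\delta_{st}$ used in its definition, the PTDF matrix $D$ satisfies: (i) $D=BC^TL^\dagger C$. (ii) For every line $\ell\in E$, $$D_{\ell\ell}=1-\frac{\sum_{\mathcal E\in T\setminus\{\ell\}}\beta(\mathcal E)}{\sum_{\mathcal E\in T}\beta(\mathcal E)},\qquad\text{and hence } 0<D_{\ell\ell}\le 1.$$ (iii) For every line $\ell=(i,j)\in E$, $$D_{\ell\ell}=b_\ell\left(L^\dagger_{ii}+L^\dagger_{jj}-2L^\dagger_{ij}\right)=b_\ell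 R_{ij}.$$ -/

import Mathlib

open Matrix

/-- `X` satisfies the four Penrose equations for the real matrix `A`. -/
structure IsMoorePenrose {m n : Type*} [Fintype m] [Fintype n]
    (A : Matrix m n ℝ) (X : Matrix n m ℝ) : Prop where
  mul_mul_self : A * X * A = A
  self_mul_mul : X * A * X = X
  symm_left : (A * X)ᵀ = A * X
  symm_right : (X * A)ᵀ = X * A

/-- The Penrose equations determine the pseudo-inverse. -/
theorem IsMoorePenrose.unique {m n : Type*} [Fintype m] [Fintype n]
    {A : Matrix m n ℝ} {X Y : Matrix n m ℝ}
    (hX : IsMoorePenrose A X) (hY : IsMoorePenrose A Y) : X = Y := by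
  have h1 : A * X = A * Y := by
    calc A * X = (A * X)ᵀ := hX.symm_left.symm
      _ = ((A * Y) * (A * X))ᵀ := by
          rw [← Matrix.mul_assoc (A * Y) A X, hY.mul_mul_self]
      _ = (A * X) * (A * Y) := by
          rw [Matrix.transpose_mul, hX.symm_left, hY.symm_left]
      _ = A * Y := by rw [← Matrix.mul_assoc (A * X) A Y, hX.mul_mul_self]
  have h2 : X * A = Y * A := by
    calc X * A = (X * A)ᵀ := hX.symm_right.symm
      _ = ((X * A) * (Y * A))ᵀ := by
          rw [Matrix.mul_assoc X A (Y * A), ← Matrix.mul_assoc A Y A, hY.mul_mul_self]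
      _ = (Y * A) * (X * A) := by
          rw [Matrix.transpose_mul, hX.symm_right, hY.symm_right]
      _ = Y * A := by
          rw [Matrix.mul_assoc Y A (X * A), ← Matrix.mul_assoc A X A, hX.mul_mul_self]
  calc X = X * A * X := hX.self_mul_mul.symm
    _ = Y * A * X := by rw [h2]
    _ = Y * (A * Y) := by rw [Matrix.mul_assoc, h1]
    _ = Y := by rw [← Matrix.mul_assoc, hY.self_mul_mul]

/-- Every real symmetric matrix has a Moore-Penrose pseudo-inverse. -/
theorem exists_isMoorePenrose {n : Type*} [Fintype n] (A : Matrix n n ℝ) (hA : Aᵀ = A) :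
    ∃ X, IsMoorePenrose A X := by
  classical
  have hH : A.IsHermitian := by
    rw [Matrix.IsHermitian, Matrix.conjTranspose_eq_transpose_of_trivial, hA]
  obtain ⟨U, d, hU, hAU⟩ : ∃ (U : Matrix n n ℝ) (d : n → ℝ),
      Uᵀ * U = 1 ∧ A = U * diagonal d * Uᵀ := by
    refine ⟨hH.eigenvectorUnitary, hH.eigenvalues, ?_, ?_⟩
    · have := Unitary.coe_star_mul_self hH.eigenvectorUnitary
      rwa [Matrix.star_eq_conjTranspose,
        Matrix.conjTranspose_eq_transpose_of_trivial] at this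
    · have := hH.spectral_theorem
      rw [Unitary.conjStarAlgAut_apply, Matrix.star_eq_conjTranspose,
        Matrix.conjTranspose_eq_transpose_of_trivial] at this
      simpa [Function.comp_def] using this
  have key : ∀ a c : n → ℝ, (U * diagonal a * Uᵀ) * (U * diagonal c * Uᵀ)
      = U * diagonal (fun i => a i * c i) * Uᵀ := by
    intro a c
    calc (U * diagonal a * Uᵀ) * (U * diagonal c * Uᵀ)
        = U * diagonal a * (Uᵀ * U) * diagonal c * Uᵀ := by simp only [Matrix.mul_assoc]
      _ = U * (diagonal a * diagonal c) * Uᵀ := by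
          rw [hU, Matrix.mul_one, Matrix.mul_assoc U]
      _ = _ := by rw [Matrix.diagonal_mul_diagonal]
  have ht : ∀ a : n → ℝ, (U * diagonal a * Uᵀ)ᵀ = U * diagonal a * Uᵀ := by
    intro a
    simp [Matrix.transpose_mul, Matrix.mul_assoc]
  refine ⟨U * diagonal (fun i => (d i)⁻¹) * Uᵀ, ?_, ?_, ?_, ?_⟩
  · rw [hAU, key, key]; congr 3; funext i
    by_cases h : d i = 0 <;> simp [h]
  · rw [hAU, key, key]; congr 3; funext i
    by_cases h : d i = 0 <;> simp [h]
  · rw [hAU, key, ht]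
  · rw [hAU, key, ht]

open Classical in
/-- The Moore-Penrose pseudo-inverse of a real square matrix. -/
noncomputable def pseudoInverse {n : Type*} [Fintype n] (A : Matrix n n ℝ) : Matrix n n ℝ :=
  if h : ∃ X, IsMoorePenrose A X then h.choose else 0

theorem pseudoInverse_spec {n : Type*} [Fintype n] (A : Matrix n n ℝ) (hA : Aᵀ = A) :
    IsMoorePenrose A (pseudoInverse A) := by
  have h := exists_isMoorePenrose A hA
  rw [pseudoInverse, dif_pos h]
  exact h.choose_spec

/-- A power network on the vertex set `V`: a simple graph, a positive susceptance for every
edge, and an arbitrary orientation of every edge. -/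
structure PowerNetwork (V : Type*) where
  /-- the underlying undirected graph -/
  graph : SimpleGraph V
  /-- the susceptances -/
  b : graph.edgeSet → ℝ
  b_pos : ∀ l, 0 < b l
  /-- the source of a line -/
  src : graph.edgeSet → V
  /-- the target of a line -/
  tgt : graph.edgeSet → V
  src_tgt : ∀ l, s(src l, tgt l) = (l : Sym2 V)

namespace PowerNetwork

/-- The lines (edges) of the network. -/
abbrev Line {V : Type*} (N : PowerNetwork V) : Type _ := N.graph.edgeSet

noncomputable instance instFintypeLine {V : Type*} [Fintype V] (N : PowerNetwork V) :
    Fintype N.Line := Fintype.ofFinite _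

/-- The diagonal matrix of the susceptances. -/
def B {V : Type*} [DecidableEq V] (N : PowerNetwork V) : Matrix N.Line N.Line ℝ :=
  diagonal N.b

/-- The vertex-edge incidence matrix. -/
def C {V : Type*} [DecidableEq V] (N : PowerNetwork V) : Matrix V N.Line ℝ :=
  Matrix.of fun i l => if i = N.src l then 1 else if i = N.tgt l then -1 else 0

/-- The weighted Laplacian matrix. -/
noncomputable def L {V : Type*} [Fintype V] [DecidableEq V] (N : PowerNetwork V) :
    Matrix V V ℝ :=
  N.C * N.B * N.Cᵀ

/-- The pseudo-inverse of the weighted Laplacian matrix. -/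
noncomputable def Ldag {V : Type*} [Fintype V] [DecidableEq V] (N : PowerNetwork V) :
    Matrix V V ℝ :=
  pseudoInverse N.L

theorem L_transpose {V : Type*} [Fintype V] [DecidableEq V] (N : PowerNetwork V) :
    N.Lᵀ = N.L := by
  simp [L, B, Matrix.transpose_mul, Matrix.mul_assoc]

theorem isMoorePenrose_Ldag {V : Type*} [Fintype V] [DecidableEq V] (N : PowerNetwork V) :
    IsMoorePenrose N.L N.Ldag :=
  pseudoInverse_spec _ N.L_transpose

/-- An injection vector is balanced if it lies in the image of the Laplacian matrix. -/
def Balanced {V : Type*} [Fintype V] [DecidableEq V] (N : PowerNetwork V) (p : V → ℝ) : Prop :=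
  ∃ θ : V → ℝ, N.L *ᵥ θ = p

/-- `f` solves the DC power flow equations with injections `p`: flow conservation holds, and
for some vector `θ` of phase angles Kirchhoff's laws hold. -/
def IsDCFlow {V : Type*} [Fintype V] [DecidableEq V] (N : PowerNetwork V)
    (p : V → ℝ) (f : N.Line → ℝ) : Prop :=
  p = N.C *ᵥ f ∧ ∃ θ : V → ℝ, f = (N.B * N.Cᵀ) *ᵥ θ

/-- The DC power flow equations have exactly one solution for balanced injections. -/
theorem existsUnique_isDCFlow {V : Type*} [Fintype V] [DecidableEq V] (N : PowerNetwork V)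
    {p : V → ℝ} (hp : N.Balanced p) : ∃! f, N.IsDCFlow p f := by
  obtain ⟨θ, rfl⟩ := hp
  refine ⟨(N.B * N.Cᵀ) *ᵥ θ, ⟨?_, θ, rfl⟩, ?_⟩
  · rw [Matrix.mulVec_mulVec, L, Matrix.mul_assoc]
  rintro _ ⟨h, η, rfl⟩
  set z : N.Line → ℝ := N.Cᵀ *ᵥ (η - θ) with hz
  have h0 : N.C *ᵥ (N.B *ᵥ z) = 0 := by
    rw [hz, Matrix.mulVec_mulVec, Matrix.mulVec_mulVec, Matrix.mulVec_sub, sub_eq_zero]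
    rw [L, Matrix.mulVec_mulVec, ← Matrix.mul_assoc] at h
    exact h.symm
  have h1 : ∑ l, N.b l * z l ^ 2 = 0 := by
    have h2 : (η - θ) ⬝ᵥ (N.C *ᵥ (N.B *ᵥ z)) = 0 := by rw [h0, dotProduct_zero]
    rw [Matrix.dotProduct_mulVec, ← Matrix.mulVec_transpose, ← hz] at h2
    rw [← h2, dotProduct]
    refine Finset.sum_congr rfl fun l _ => ?_
    rw [B, Matrix.mulVec_diagonal]
    ring
  have h3 : z = 0 := by
    funext l
    have h4 := (Finset.sum_eq_zero_iff_of_nonneg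
      (fun l _ => mul_nonneg (N.b_pos l).le (sq_nonneg (z l)))).1 h1 l (Finset.mem_univ l)
    have h5 := (mul_eq_zero.1 h4).resolve_left (N.b_pos l).ne'
    simpa using h5
  have h6 : N.B *ᵥ z = 0 := by rw [h3, Matrix.mulVec_zero]
  rw [hz, Matrix.mulVec_mulVec, Matrix.mulVec_sub, sub_eq_zero] at h6
  exact h6

open Classical in
/-- The line flows determined by the injections `p` through the DC power flow equations. -/
noncomputable def flow {V : Type*} [Fintype V] [DecidableEq V] (N : PowerNetwork V)
    (p : V → ℝ) : N.Line → ℝ :=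
  if h : ∃ f, N.IsDCFlow p f then h.choose else 0

theorem isDCFlow_flow {V : Type*} [Fintype V] [DecidableEq V] (N : PowerNetwork V)
    {p : V → ℝ} (hp : N.Balanced p) : N.IsDCFlow p (N.flow p) := by
  have h := (N.existsUnique_isDCFlow hp).exists
  rw [flow, dif_pos h]
  exact h.choose_spec

/-- The power transfer distribution factor of the line `l` for the vertices `s` and `t`,
computed from the initial injections `p` and the injection change `δ`. -/
noncomputable def ptdf {V : Type*} [Fintype V] [DecidableEq V] (N : PowerNetwork V)
    (p : V → ℝ) (δ : ℝ) (l : N.Line) (s t : V) : ℝ :=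
  if s = t then 0
  else (N.flow (p + δ • (Pi.single s 1 - Pi.single t 1)) l - N.flow p l) / δ

/-- The PTDF matrix, computed from the initial injections `p` and the injection changes
`δ s t`. -/
noncomputable def ptdfMatrix {V : Type*} [Fintype V] [DecidableEq V] (N : PowerNetwork V)
    (p : V → ℝ) (δ : V → V → ℝ) : Matrix N.Line N.Line ℝ :=
  Matrix.of fun l k => N.ptdf p (δ (N.src k) (N.tgt k)) l (N.src k) (N.tgt k)

/-- The effective resistance between two vertices. -/
noncomputable def effectiveResistance {V : Type*} [Fintype V] [DecidableEq V]
    (N : PowerNetwork V) (i j : V) : ℝ :=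
  (Pi.single i 1 - Pi.single j 1) ⬝ᵥ (N.Ldag *ᵥ (Pi.single i 1 - Pi.single j 1))

open Classical in
/-- The weight of a set of lines: the product of the susceptances, with the convention that
the empty set has weight `0` unless the network has no line at all. -/
noncomputable def β {V : Type*} (N : PowerNetwork V) (F : Finset N.Line) : ℝ :=
  if F = ∅ ∧ Nonempty N.Line then 0 else ∏ l ∈ F, N.b l

open Classical in
/-- The (edge sets of) spanning trees of the network that use only lines of `S`. -/
noncomputable def spanningTrees {V : Type*} [Fintype V] (N : PowerNetwork V)
    (S : Finset N.Line) : Finset (Finset N.Line) :=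
  S.powerset.filter fun F =>
    (SimpleGraph.fromEdgeSet ((fun l : N.Line => (l : Sym2 V)) '' (F : Set N.Line))).IsTree

end PowerNetwork

/-! Each spanning tree F routes a unit from the source to the target of every line along its tree
path. `treeFlow F` collects these routings as columns, and each conserves flow (`C_mul_treeFlow`).
Averaging over all trees with weights ∏ b keeps conservation and also yields Kirchhoff's voltage
law. To see this, note that row l of `treeFlow F` consists of differences of the indicator of one
side of the cut made by deleting l. Rows of the average are therefore potential differences. The
exchange F ↦ F - l + k shows that the average is symmetric up to the susceptances (`treeSum_mul_b`),
so its columns are DC flows.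

The columns of B Cᵀ L† C solve the same equations, so by uniqueness the two matrices agree
(`B_mul_C_transpose_mul_Ldag_mul_C`). On the diagonal, a tree contributes 1 if it contains l and 0
otherwise, which gives (ii). Superposition gives (i), and symmetry of L† gives (iii). -/

namespace SimpleGraph

/-! ### Adding and removing one edge of a tree -/

variable {V : Type*} {G : SimpleGraph V} {u v x y : V}

/-- Removing an edge from a tree separates its two endpoints. -/
theorem IsTree.not_reachable_of_sup_edge (h : (G ⊔ edge u v).IsTree) (huv : u ≠ v)
    (hadj : ¬ G.Adj u v) : ¬ G.Reachable u v := fun hr =>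
  ((isAcyclic_sup_fromEdgeSet_iff.1 h.isAcyclic).2 hr).elim huv hadj

/-- Removing an edge from a connected graph leaves at most two components. -/
theorem Connected.reachable_or_reachable_of_sup_edge (h : (G ⊔ edge u v).Connected) (w : V) :
    G.Reachable u w ∨ G.Reachable v w := by
  have key : ∀ {a b : V}, (G ⊔ edge u v).Walk a b →
      (G.Reachable u a ∨ G.Reachable v a) → (G.Reachable u b ∨ G.Reachable v b) := by
    intro a b p
    induction p with
    | nil => exact id
    | @cons a c d hac _ ih =>
      intro ha
      refine ih ?_
      rw [sup_adj, edge_adj] at hac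
      rcases hac with hac | ⟨⟨rfl, rfl⟩ | ⟨rfl, rfl⟩, _⟩
      · exact ha.imp (·.trans hac.reachable) (·.trans hac.reachable)
      · exact Or.inr (Reachable.refl _)
      · exact Or.inl (Reachable.refl _)
  obtain ⟨p⟩ := h.preconnected u w
  exact key p (Or.inl (Reachable.refl _))

/-- Joining the two components of a forest by an edge gives a tree. -/
theorem IsAcyclic.isTree_sup_edge (h : G.IsAcyclic) (hxy : ¬ G.Reachable x y)
    (hcov : ∀ w, G.Reachable u w ∨ G.Reachable v w) : (G ⊔ edge x y).IsTree := by
  have hne : x ≠ y := fun e => hxy (e ▸ Reachable.refl _)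
  have hx : ∀ w, G.Reachable x w ∨ G.Reachable y w := by
    intro w
    -- Of the two components, `x` and `y` occupy one each, so `w` shares a component with one of
    -- them.
    rcases hcov x with hx | hx <;> rcases hcov y with hy | hy <;> rcases hcov w with hw | hw
    all_goals first
      | exact absurd (hx.symm.trans hy) hxy
      | exact Or.inl (hx.symm.trans hw)
      | exact Or.inr (hy.symm.trans hw)
  have hadj : (G ⊔ edge x y).Adj x y := Or.inr ((edge_adj ..).2 ⟨Or.inl ⟨rfl, rfl⟩, hne⟩)
  have hx' : ∀ w, (G ⊔ edge x y).Reachable x w := fun w =>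
    (hx w).elim (·.mono le_sup_left) fun hw => hadj.reachable.trans (hw.mono le_sup_left)
  exact ⟨{ preconnected := fun a c => (hx' a).symm.trans (hx' c), nonempty := ⟨x⟩ },
    h.sup_edge_of_not_reachable hxy⟩

end SimpleGraph

/-! ### Sets of lines as spanning subgraphs -/

namespace PowerNetwork

variable {V : Type*} (N : PowerNetwork V)

theorem adj_src_tgt (l : N.Line) : N.graph.Adj (N.src l) (N.tgt l) := by
  rw [← SimpleGraph.mem_edgeSet, N.src_tgt]
  exact l.2

theorem src_ne_tgt (l : N.Line) : N.src l ≠ N.tgt l := (N.adj_src_tgt l).ne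

/-- The spanning subgraph with a given set of lines. -/
def lineGraph (F : Finset N.Line) : SimpleGraph V :=
  SimpleGraph.fromEdgeSet ((fun l : N.Line => (l : Sym2 V)) '' (F : Set N.Line))

variable {N}

theorem lineGraph_adj {F : Finset N.Line} {u v : V} :
    (N.lineGraph F).Adj u v ↔ ∃ l ∈ F, (l : Sym2 V) = s(u, v) := by
  rw [lineGraph, SimpleGraph.fromEdgeSet_adj]
  constructor
  · rintro ⟨⟨l, hl, h⟩, -⟩
    exact ⟨l, hl, h⟩
  · rintro ⟨l, hl, h⟩
    exact ⟨⟨l, hl, h⟩, SimpleGraph.Adj.ne (G := N.graph) (by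
      rw [← SimpleGraph.mem_edgeSet, ← h]; exact l.2)⟩

theorem lineGraph_adj_src_tgt {F : Finset N.Line} {l : N.Line} :
    (N.lineGraph F).Adj (N.src l) (N.tgt l) ↔ l ∈ F := by
  rw [lineGraph_adj, N.src_tgt]
  constructor
  · rintro ⟨k, hk, h⟩
    rwa [← Subtype.ext h]
  · exact fun h => ⟨l, h, rfl⟩

theorem lineGraph_insert [DecidableEq V] (F : Finset N.Line) (l : N.Line) :
    N.lineGraph (insert l F) = N.lineGraph F ⊔ SimpleGraph.edge (N.src l) (N.tgt l) := by
  rw [lineGraph, lineGraph, SimpleGraph.edge, N.src_tgt, ← SimpleGraph.fromEdgeSet_union,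
    Finset.coe_insert, Set.image_insert_eq, Set.insert_eq, Set.union_comm]

/-! ### Spanning trees and their weights -/

section Trees

variable [Fintype V]

theorem mem_spanningTrees {S F : Finset N.Line} :
    F ∈ N.spanningTrees S ↔ F ⊆ S ∧ (N.lineGraph F).IsTree := by
  simp [spanningTrees, lineGraph]

theorem mem_spanningTrees_univ {F : Finset N.Line} :
    F ∈ N.spanningTrees Finset.univ ↔ (N.lineGraph F).IsTree := by
  simp [mem_spanningTrees]

/-- Every line of a connected network lies in a spanning tree. -/
theorem exists_mem_spanningTrees (hconn : N.graph.Connected) (l : N.Line) :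
    ∃ F ∈ N.spanningTrees Finset.univ, l ∈ F := by
  classical
  have hac : (SimpleGraph.edge (N.src l) (N.tgt l)).IsAcyclic := by
    rw [← bot_sup_eq (SimpleGraph.edge (N.src l) (N.tgt l))]
    refine SimpleGraph.isAcyclic_bot.sup_edge_of_not_reachable fun h => ?_
    exact N.src_ne_tgt l (SimpleGraph.reachable_bot.1 h)
  have hle : SimpleGraph.edge (N.src l) (N.tgt l) ≤ N.graph :=
    (SimpleGraph.edge_le_iff _).2 (Or.inr (N.adj_src_tgt l))
  obtain ⟨T, hlT, hTG, hT⟩ := hconn.exists_isTree_le_of_le_of_isAcyclic hle hac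
  have hF : N.lineGraph (Finset.univ.filter fun k : N.Line => (k : Sym2 V) ∈ T.edgeSet) = T := by
    ext u v
    rw [lineGraph_adj]
    constructor
    · rintro ⟨k, hk, h⟩
      rw [← SimpleGraph.mem_edgeSet, ← h]
      exact (Finset.mem_filter.1 hk).2
    · intro h
      exact ⟨⟨s(u, v), hTG h⟩, Finset.mem_filter.2 ⟨Finset.mem_univ _, h⟩, rfl⟩
  refine ⟨_, mem_spanningTrees_univ.2 (hF.symm ▸ hT), ?_⟩
  rw [← lineGraph_adj_src_tgt, hF]
  exact hlT ((SimpleGraph.edge_adj ..).2 ⟨Or.inl ⟨rfl, rfl⟩, N.src_ne_tgt l⟩)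

/-- The weighted number of spanning trees. -/
noncomputable def treeWeight (N : PowerNetwork V) : ℝ :=
  ∑ F ∈ N.spanningTrees Finset.univ, ∏ e ∈ F, N.b e

theorem treeWeight_pos (hconn : N.graph.Connected) (l : N.Line) : 0 < N.treeWeight := by
  obtain ⟨F, hF, -⟩ := exists_mem_spanningTrees hconn l
  exact Finset.sum_pos (fun F _ => Finset.prod_pos fun e _ => N.b_pos e) ⟨F, hF⟩

/-- The convention for the empty set is harmless: once a line exists, its two distinct ends are not
joined by the empty set, which is thus not a spanning tree. -/
theorem β_eq_prod {F : Finset N.Line}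
    (hF : F ∈ N.spanningTrees Finset.univ) : N.β F = ∏ e ∈ F, N.b e := by
  rw [β, if_neg]
  rintro ⟨rfl, ⟨l⟩⟩
  have hr := (mem_spanningTrees_univ.1 hF).connected.preconnected (N.src l) (N.tgt l)
  rw [lineGraph, Finset.coe_empty, Set.image_empty, SimpleGraph.fromEdgeSet_empty,
    SimpleGraph.reachable_bot] at hr
  exact N.src_ne_tgt l hr

end Trees

/-! ### Exchange of tree edges -/

section Exchange

variable [DecidableEq V]

theorem not_reachable_erase {F : Finset N.Line} (hF : (N.lineGraph F).IsTree) {l : N.Line}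
    (hl : l ∈ F) : ¬ (N.lineGraph (F.erase l)).Reachable (N.src l) (N.tgt l) := by
  rw [← Finset.insert_erase hl, lineGraph_insert] at hF
  refine hF.not_reachable_of_sup_edge (N.src_ne_tgt l) ?_
  rw [lineGraph_adj_src_tgt]
  exact Finset.notMem_erase l F

theorem reachable_or_reachable_erase {F : Finset N.Line} (hF : (N.lineGraph F).IsTree)
    {l : N.Line} (hl : l ∈ F) (w : V) :
    (N.lineGraph (F.erase l)).Reachable (N.src l) w ∨
      (N.lineGraph (F.erase l)).Reachable (N.tgt l) w := by
  rw [← Finset.insert_erase hl, lineGraph_insert] at hF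
  exact hF.connected.reachable_or_reachable_of_sup_edge w

theorem isAcyclic_erase {F : Finset N.Line} (hF : (N.lineGraph F).IsTree)
    {l : N.Line} (hl : l ∈ F) : (N.lineGraph (F.erase l)).IsAcyclic := by
  rw [← Finset.insert_erase hl, lineGraph_insert] at hF
  exact hF.isAcyclic.anti le_sup_left

/-- The exchange property of spanning trees. -/
theorem isTree_exchange {F : Finset N.Line} (hF : (N.lineGraph F).IsTree)
    {l k : N.Line} (hl : l ∈ F)
    (hk : ¬ (N.lineGraph (F.erase l)).Reachable (N.src k) (N.tgt k)) :
    (N.lineGraph (insert k (F.erase l))).IsTree := by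
  rw [lineGraph_insert]
  exact (isAcyclic_erase hF hl).isTree_sup_edge hk (reachable_or_reachable_erase hF hl)

theorem insert_erase_exchange {F : Finset N.Line} {l k : N.Line} (hl : l ∈ F)
    (hk : k ∉ F.erase l) : insert l ((insert k (F.erase l)).erase k) = F := by
  rw [Finset.erase_insert hk, Finset.insert_erase hl]

theorem C_col (k : N.Line) :
    N.C.col k = Pi.single (N.src k) 1 - Pi.single (N.tgt k) 1 := by
  ext i
  have := N.src_ne_tgt k
  by_cases h1 : i = N.src k
  · subst h1; simp [C, this]
  · by_cases h2 : i = N.tgt k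
    · subst h2; simp [C, h1]
    · simp [C, h1, h2]

end Exchange

/-! ### Cuts and unit flows along a tree -/

section Cut

open Classical in
/-- The rows are the indicators of the components of the source of `l` in `F \ {l}`. -/
noncomputable def cutPotential [DecidableEq V] (N : PowerNetwork V) (F : Finset N.Line) :
    Matrix N.Line V ℝ :=
  Matrix.of fun l v =>
    if l ∈ F ∧ (N.lineGraph (F.erase l)).Reachable (N.src l) v then 1 else 0

variable [Fintype V] [DecidableEq V]

theorem mul_C_apply {m : Type*} (X : Matrix m V ℝ) (i : m) (k : N.Line) :
    (X * N.C) i k = X i (N.src k) - X i (N.tgt k) := by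
  have h : ∀ v, X i v * N.C v k =
      (if v = N.src k then X i v else 0) - (if v = N.tgt k then X i v else 0) := by
    intro v
    have := N.src_ne_tgt k
    by_cases h1 : v = N.src k
    · subst h1; simp [C, this]
    · by_cases h2 : v = N.tgt k
      · subst h2; simp [C, h1]
      · simp [C, h1, h2]
  rw [Matrix.mul_apply, Finset.sum_congr rfl fun v _ => h v, Finset.sum_sub_distrib]
  simp

/-- The distribution matrix of a spanning tree. -/
noncomputable def treeFlow (N : PowerNetwork V) (F : Finset N.Line) : Matrix N.Line N.Line ℝ :=
  N.cutPotential F * N.C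

theorem treeFlow_of_notMem {F : Finset N.Line} {l : N.Line} (hl : l ∉ F) (k : N.Line) :
    N.treeFlow F l k = 0 := by
  simp [treeFlow, mul_C_apply, cutPotential, hl]

/-- The line k does not cross the cut of l, so the indicator takes the same value at both of its
ends. -/
theorem treeFlow_of_reachable {F : Finset N.Line} {l k : N.Line}
    (h : (N.lineGraph (F.erase l)).Reachable (N.src k) (N.tgt k)) :
    N.treeFlow F l k = 0 := by
  have : (N.lineGraph (F.erase l)).Reachable (N.src l) (N.src k) ↔
      (N.lineGraph (F.erase l)).Reachable (N.src l) (N.tgt k) :=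
    ⟨(·.trans h), (·.trans h.symm)⟩
  by_cases hr : (N.lineGraph (F.erase l)).Reachable (N.src l) (N.tgt k) <;>
    simp [treeFlow, mul_C_apply, cutPotential, this, hr]

theorem treeFlow_self {F : Finset N.Line} (hF : (N.lineGraph F).IsTree) {l : N.Line}
    (hl : l ∈ F) : N.treeFlow F l l = 1 := by
  simp [treeFlow, mul_C_apply, cutPotential, hl, not_reachable_erase hF hl]

theorem treeFlow_of_mem {F : Finset N.Line} (hF : (N.lineGraph F).IsTree) {k : N.Line}
    (hk : k ∈ F) (l : N.Line) : N.treeFlow F l k = if l = k then 1 else 0 := by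
  split_ifs with h
  · rw [h, treeFlow_self hF hk]
  · exact treeFlow_of_reachable
      (lineGraph_adj_src_tgt.2 (Finset.mem_erase.2 ⟨Ne.symm h, hk⟩)).reachable

/-- The flow prescribed by a spanning tree satisfies flow conservation. -/
theorem C_mul_treeFlow {F : Finset N.Line} (hF : (N.lineGraph F).IsTree) :
    N.C * N.treeFlow F = N.C := by
  -- On the lines of `F` the matrix `treeFlow F` is the identity, so `A` kills those columns of `C`.
  -- Rows of `A` are then constant along tree edges, hence on all of `V`, and `A` kills every
  -- column.
  set A : Matrix V V ℝ := 1 - N.C * N.cutPotential F with hA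
  have hzero : A * N.C = 0 := by
    have hF0 : ∀ (i : V), ∀ k ∈ F, (A * N.C) i k = 0 := by
      intro i k hk
      rw [hA, Matrix.sub_mul, Matrix.one_mul, Matrix.mul_assoc, Matrix.sub_apply, Matrix.mul_apply]
      change N.C i k - ∑ l, N.C i l * N.treeFlow F l k = 0
      simp [treeFlow_of_mem hF hk]
    have hadj : ∀ (i u v : V), (N.lineGraph F).Adj u v →
        A i u = A i v := by
      intro i u v h
      obtain ⟨k, hk, he⟩ := lineGraph_adj.1 h
      have h0 := hF0 i k hk
      rw [mul_C_apply, sub_eq_zero] at h0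
      rw [← N.src_tgt k, Sym2.eq_iff] at he
      rcases he with ⟨rfl, rfl⟩ | ⟨rfl, rfl⟩
      · exact h0
      · exact h0.symm
    have hwalk : ∀ (i : V) {u v : V}, (N.lineGraph F).Walk u v →
        A i u = A i v := by
      intro i u v p
      induction p with
      | nil => rfl
      | cons h _ ih => exact (hadj i _ _ h).trans ih
    ext i k
    obtain ⟨p⟩ := hF.connected.preconnected (N.src k) (N.tgt k)
    rw [mul_C_apply, hwalk i p, sub_self, Matrix.zero_apply]
  rw [hA, Matrix.sub_mul, Matrix.one_mul, sub_eq_zero, Matrix.mul_assoc] at hzero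
  exact hzero.symm

theorem not_reachable_of_treeFlow_ne_zero {F : Finset N.Line} {l k : N.Line}
    (h : N.treeFlow F l k ≠ 0) :
    ¬ (N.lineGraph (F.erase l)).Reachable (N.src k) (N.tgt k) :=
  fun hr => h (treeFlow_of_reachable hr)

theorem mem_of_treeFlow_ne_zero {F : Finset N.Line} {l k : N.Line}
    (h : N.treeFlow F l k ≠ 0) : l ∈ F :=
  not_not.1 fun hl => h (treeFlow_of_notMem hl k)

theorem notMem_erase_of_treeFlow_ne_zero {F : Finset N.Line} {l k : N.Line}
    (h : N.treeFlow F l k ≠ 0) : k ∉ F.erase l := fun hk =>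
  not_reachable_of_treeFlow_ne_zero h (lineGraph_adj_src_tgt.2 hk).reachable

/-- Deleting l from F and deleting k from F - l + k leave the same two-component forest. Both lines
cross this cut, and the entry is the sign telling whether they cross it in the same direction, which
is symmetric in l and k. -/
theorem treeFlow_exchange {F : Finset N.Line} (hF : (N.lineGraph F).IsTree) {l k : N.Line}
    (h : N.treeFlow F l k ≠ 0) :
    N.treeFlow (insert k (F.erase l)) k l = N.treeFlow F l k := by
  classical
  have hl := mem_of_treeFlow_ne_zero h
  have hk := not_reachable_of_treeFlow_ne_zero h
  have hkl := not_reachable_erase hF hl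
  have hcov := reachable_or_reachable_erase hF hl
  have hcov' := reachable_or_reachable_erase (isTree_exchange hF hl hk)
    (Finset.mem_insert_self k (F.erase l))
  rw [Finset.erase_insert (notMem_erase_of_treeFlow_ne_zero h)] at hcov'
  have h1 : (N.lineGraph (F.erase l)).Reachable (N.src k) (N.src l) ↔
      (N.lineGraph (F.erase l)).Reachable (N.src l) (N.src k) := SimpleGraph.reachable_comm
  have h2 : (N.lineGraph (F.erase l)).Reachable (N.src k) (N.tgt l) ↔
      (N.lineGraph (F.erase l)).Reachable (N.src l) (N.tgt k) := by
    constructor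
    · intro ht
      exact (hcov (N.tgt k)).resolve_right fun h' => hk (ht.trans h')
    · intro ht
      exact (hcov' (N.tgt l)).resolve_right fun h' => hkl (ht.trans h')
  simp [treeFlow, mul_C_apply, cutPotential, hl, h1, h2,
    Finset.erase_insert (notMem_erase_of_treeFlow_ne_zero h)]

end Cut

/-! ### The average over spanning trees as a DC flow -/

section Kirchhoff

variable [Fintype V] [DecidableEq V]

/-- The sum of the distribution matrices of all spanning trees, weighted by the products of the
susceptances. -/
noncomputable def treeSum (N : PowerNetwork V) : Matrix N.Line N.Line ℝ :=
  ∑ F ∈ N.spanningTrees Finset.univ, (∏ e ∈ F, N.b e) • N.treeFlow F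

theorem treeSum_apply (l k : N.Line) : N.treeSum l k =
    ∑ F ∈ N.spanningTrees Finset.univ, (∏ e ∈ F, N.b e) * N.treeFlow F l k := by
  simp [treeSum, Matrix.sum_apply]

theorem C_mul_treeSum : N.C * N.treeSum = N.treeWeight • N.C := by
  rw [treeSum, treeWeight, Matrix.mul_sum, Finset.sum_smul]
  refine Finset.sum_congr rfl fun F hF => ?_
  rw [Matrix.mul_smul, C_mul_treeFlow (mem_spanningTrees_univ.1 hF)]

/-- Reciprocity: the weighted sum of the tree distribution matrices is symmetric up to the
susceptances. -/
theorem treeSum_mul_b (l k : N.Line) : N.treeSum l k * N.b k = N.treeSum k l * N.b l := by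
  rw [treeSum_apply, treeSum_apply, Finset.sum_mul, Finset.sum_mul]
  have hne : ∀ {F : Finset N.Line} {l k : N.Line},
      (∏ e ∈ F, N.b e) * N.treeFlow F l k * N.b k ≠ 0 → N.treeFlow F l k ≠ 0 :=
    fun h => right_ne_zero_of_mul (left_ne_zero_of_mul h)
  have hmem : ∀ {F : Finset N.Line} {l k : N.Line}, F ∈ N.spanningTrees Finset.univ →
      N.treeFlow F l k ≠ 0 → insert k (F.erase l) ∈ N.spanningTrees Finset.univ :=
    fun hF h => mem_spanningTrees_univ.2 (isTree_exchange (mem_spanningTrees_univ.1 hF)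
      (mem_of_treeFlow_ne_zero h) (not_reachable_of_treeFlow_ne_zero h))
  have hinv : ∀ {F : Finset N.Line} {l k : N.Line}, N.treeFlow F l k ≠ 0 →
      insert l ((insert k (F.erase l)).erase k) = F :=
    fun h => insert_erase_exchange (mem_of_treeFlow_ne_zero h)
      (notMem_erase_of_treeFlow_ne_zero h)
  have hval : ∀ {F : Finset N.Line} {l k : N.Line}, F ∈ N.spanningTrees Finset.univ →
      N.treeFlow F l k ≠ 0 → (∏ e ∈ F, N.b e) * N.treeFlow F l k * N.b k =
      (∏ e ∈ insert k (F.erase l), N.b e) * N.treeFlow (insert k (F.erase l)) k l * N.b l := by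
    intro F l k hF h
    rw [treeFlow_exchange (mem_spanningTrees_univ.1 hF) h,
      Finset.prod_insert (notMem_erase_of_treeFlow_ne_zero h),
      ← Finset.mul_prod_erase F N.b (mem_of_treeFlow_ne_zero h)]
    ring
  -- The exchange yields a tree only when k crosses the cut of l, so the bijection is between
  -- nonzero terms; its inverse swaps the roles of l and k.
  refine Finset.sum_bij_ne_zero (fun F _ _ => insert k (F.erase l))
    (fun F hF h => hmem hF (hne h)) ?_ ?_ (fun F hF h => hval hF (hne h))
  · intro F₁ _ h₁ F₂ _ h₂ h
    rw [← hinv (hne h₁), ← hinv (hne h₂), h]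
  · intro F hF h
    refine ⟨insert l (F.erase k), hmem hF (hne h), ?_, hinv (hne h)⟩
    rwa [← hval hF (hne h)]

/-- Phase angles that produce the averaged tree flows. -/
noncomputable def treePotential (N : PowerNetwork V) : Matrix V N.Line ℝ :=
  Matrix.of fun v k => (N.treeWeight)⁻¹ *
    (∑ F ∈ N.spanningTrees Finset.univ, (∏ e ∈ F, N.b e) * N.cutPotential F k v) / N.b k

/-- By construction row k of `treeSum` is a vector of potential differences. Reciprocity turns this
row, scaled by b l / b k, into column k. -/
theorem B_mul_C_transpose_mul_treePotential :
    N.B * N.Cᵀ * N.treePotential = N.treeWeight⁻¹ • N.treeSum := by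
  ext l k
  have hC : (N.Cᵀ * N.treePotential) l k = N.treeWeight⁻¹ * N.treeSum k l / N.b k := by
    rw [← Matrix.transpose_apply (N.Cᵀ * N.treePotential), Matrix.transpose_mul,
      Matrix.transpose_transpose, mul_C_apply, treeSum_apply]
    simp only [treePotential, Matrix.transpose_apply, Matrix.of_apply, treeFlow, mul_C_apply,
      mul_sub, Finset.sum_sub_distrib]
    ring
  have h := treeSum_mul_b (N := N) l k
  have hk := (N.b_pos k).ne'
  rw [Matrix.mul_assoc, B, Matrix.diagonal_mul, hC, Matrix.smul_apply, smul_eq_mul, mul_div_assoc',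
    div_eq_iff hk]
  linear_combination -N.treeWeight⁻¹ * h

theorem L_mul_treePotential (hconn : N.graph.Connected) : N.L * N.treePotential = N.C := by
  rw [L, Matrix.mul_assoc N.C, Matrix.mul_assoc, B_mul_C_transpose_mul_treePotential,
    Matrix.mul_smul, C_mul_treeSum]
  ext i l
  simp [(treeWeight_pos hconn l).ne']

theorem balanced_C_col (hconn : N.graph.Connected) (k : N.Line) : N.Balanced (N.C.col k) :=
  ⟨N.treePotential.col k, by
    conv_rhs => rw [← L_mul_treePotential hconn]
    ext i
    simp [Matrix.mulVec, Matrix.mul_apply, dotProduct]⟩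

theorem mul_col {m n o : Type*} [Fintype n] (X : Matrix m n ℝ) (Y : Matrix n o ℝ) (k : o) :
    (X * Y).col k = X *ᵥ Y.col k := rfl

/-- L L† fixes the image of L, and the columns of C lie in that image, as `treePotential` witnesses.
-/
theorem isDCFlow_Ldag (hconn : N.graph.Connected) (k : N.Line) :
    N.IsDCFlow (N.C.col k) ((N.B * N.Cᵀ * N.Ldag * N.C).col k) := by
  refine ⟨?_, (N.Ldag * N.C).col k, ?_⟩
  · rw [← mul_col]
    congr 1
    have h := N.isMoorePenrose_Ldag.mul_mul_self
    calc N.C = N.L * N.treePotential := (L_mul_treePotential hconn).symm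
      _ = N.L * N.Ldag * (N.L * N.treePotential) := by rw [← Matrix.mul_assoc, h]
      _ = N.L * N.Ldag * N.C := by rw [L_mul_treePotential hconn]
      _ = N.C * (N.B * N.Cᵀ * N.Ldag * N.C) := by simp only [L, Matrix.mul_assoc]
  · rw [← mul_col]
    simp only [Matrix.mul_assoc]

/-- The matrix of distribution factors is the weighted average over all spanning trees. -/
theorem B_mul_C_transpose_mul_Ldag_mul_C (hconn : N.graph.Connected) :
    N.B * N.Cᵀ * N.Ldag * N.C = N.treeWeight⁻¹ • N.treeSum := by
  ext l k
  have h : N.IsDCFlow (N.C.col k) ((N.B * N.Cᵀ * N.treePotential).col k) := by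
    refine ⟨?_, N.treePotential.col k, mul_col _ _ _⟩
    rw [← mul_col, ← Matrix.mul_assoc, ← Matrix.mul_assoc]
    exact congrArg (Matrix.col · k) (L_mul_treePotential hconn).symm
  rw [← B_mul_C_transpose_mul_treePotential]
  exact congrFun ((N.existsUnique_isDCFlow (balanced_C_col hconn k)).unique
    (isDCFlow_Ldag hconn k) h) l

/-! ### Superposition and the PTDF matrix -/

theorem IsDCFlow.add_smul {p q : V → ℝ} {f g : N.Line → ℝ} (hf : N.IsDCFlow p f)
    (hg : N.IsDCFlow q g) (c : ℝ) : N.IsDCFlow (p + c • q) (f + c • g) := by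
  obtain ⟨rfl, θ, hθ⟩ := hf
  obtain ⟨rfl, η, hη⟩ := hg
  refine ⟨by rw [Matrix.mulVec_add, Matrix.mulVec_smul], θ + c • η, ?_⟩
  rw [Matrix.mulVec_add, Matrix.mulVec_smul, ← hθ, ← hη]

theorem Balanced.add_smul {p q : V → ℝ} (hp : N.Balanced p) (hq : N.Balanced q) (c : ℝ) :
    N.Balanced (p + c • q) := by
  obtain ⟨θ, rfl⟩ := hp
  obtain ⟨η, rfl⟩ := hq
  exact ⟨θ + c • η, by rw [Matrix.mulVec_add, Matrix.mulVec_smul]⟩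

/-- By superposition and uniqueness, the injection change adds δ times a column of B Cᵀ L† C to the
flow, so the quotient depends on neither p nor δ. -/
theorem ptdfMatrix_eq (hconn : N.graph.Connected) {p : V → ℝ} (hp : N.Balanced p)
    {δ : V → V → ℝ} (hδ : ∀ s t, s ≠ t → δ s t ≠ 0) :
    N.ptdfMatrix p δ = N.B * N.Cᵀ * N.Ldag * N.C := by
  ext l k
  have hne := N.src_ne_tgt k
  have hb := hp.add_smul (balanced_C_col hconn k) (δ (N.src k) (N.tgt k))
  have hflow := (N.existsUnique_isDCFlow hb).unique (N.isDCFlow_flow hb)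
    ((N.isDCFlow_flow hp).add_smul (isDCFlow_Ldag hconn k) (δ (N.src k) (N.tgt k)))
  rw [ptdfMatrix, Matrix.of_apply, ptdf, if_neg hne, ← C_col, hflow]
  simp [hδ _ _ hne]

/-! ### Diagonal entries and effective resistance -/

theorem treeSum_diag (l : N.Line) : N.treeSum l l =
    ∑ F ∈ N.spanningTrees Finset.univ with l ∈ F, ∏ e ∈ F, N.b e := by
  rw [treeSum_apply, Finset.sum_filter]
  refine Finset.sum_congr rfl fun F hF => ?_
  split_ifs with h
  · rw [treeFlow_self (mem_spanningTrees_univ.1 hF) h, mul_one]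
  · rw [treeFlow_of_notMem h, mul_zero]

theorem spanningTrees_sdiff_singleton (l : N.Line) :
    N.spanningTrees (Finset.univ \ {l}) =
      (N.spanningTrees Finset.univ).filter fun F => l ∉ F := by
  ext F
  simp only [mem_spanningTrees, Finset.mem_filter, Finset.subset_univ, true_and, and_comm,
    Finset.subset_sdiff, Finset.disjoint_singleton_right]

/-- Since L is symmetric, transposing the Penrose equations shows that the transpose of L† is again
a pseudo-inverse of L; the two symmetry conditions trade places. -/
theorem Ldag_transpose (N : PowerNetwork V) : N.Ldagᵀ = N.Ldag := by
  have h := N.isMoorePenrose_Ldag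
  have hL := N.L_transpose
  refine IsMoorePenrose.unique (A := N.L) ⟨?_, ?_, ?_, ?_⟩ h
  · conv_rhs => rw [← hL, ← h.mul_mul_self]
    simp only [Matrix.transpose_mul, hL, Matrix.mul_assoc]
  · conv_rhs => rw [← h.self_mul_mul]
    simp only [Matrix.transpose_mul, hL, Matrix.mul_assoc]
  · have := h.symm_right
    rw [Matrix.transpose_mul, hL] at this
    rw [this, ← this, Matrix.transpose_mul, Matrix.transpose_transpose, hL, this]
  · have := h.symm_left
    rw [Matrix.transpose_mul, hL] at this
    rw [this, ← this, Matrix.transpose_mul, Matrix.transpose_transpose, hL, this]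

theorem effectiveResistance_eq (N : PowerNetwork V) (i j : V) :
    N.effectiveResistance i j = N.Ldag i i + N.Ldag j j - 2 * N.Ldag i j := by
  have h : N.Ldag j i = N.Ldag i j := congrFun (congrFun N.Ldag_transpose i) j
  simp [effectiveResistance, Matrix.mulVec_sub, sub_dotProduct, h]
  ring

theorem B_mul_C_transpose_mul_Ldag_mul_C_diag (l : N.Line) :
    (N.B * N.Cᵀ * N.Ldag * N.C) l l =
      N.b l * N.effectiveResistance (N.src l) (N.tgt l) := by
  have h : ∀ v, (N.Cᵀ * N.Ldag) l v = N.Ldag v (N.src l) - N.Ldag v (N.tgt l) := by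
    intro v
    rw [← mul_C_apply, ← Matrix.transpose_apply (N.Cᵀ * N.Ldag), Matrix.transpose_mul,
      Ldag_transpose, Matrix.transpose_transpose]
  have h' : N.Ldag (N.tgt l) (N.src l) = N.Ldag (N.src l) (N.tgt l) :=
    congrFun (congrFun N.Ldag_transpose _) _
  rw [effectiveResistance_eq, Matrix.mul_assoc N.B, mul_C_apply, B, Matrix.diagonal_mul,
    Matrix.diagonal_mul, h, h, h']
  ring

theorem effectiveResistance_comm (N : PowerNetwork V) (i j : V) :
    N.effectiveResistance i j = N.effectiveResistance j i := by
  have h : N.Ldag j i = N.Ldag i j := congrFun (congrFun N.Ldag_transpose i) j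
  rw [effectiveResistance_eq, effectiveResistance_eq, h]
  ring

end Kirchhoff

end PowerNetwork

theorem mainTheorem12 {V : Type*} [Fintype V] [DecidableEq V] (N : PowerNetwork V)
    (hconn : N.graph.Connected) (p : V → ℝ) (hp : N.Balanced p)
    (δ : V → V → ℝ) (hδ : ∀ s t, s ≠ t → δ s t ≠ 0) :
    N.ptdfMatrix p δ = N.B * N.Cᵀ * N.Ldag * N.C ∧
    (∀ l : N.Line,
      N.ptdfMatrix p δ l l =
        1 - (∑ F ∈ N.spanningTrees (Finset.univ \ {l}), N.β F) /
          (∑ F ∈ N.spanningTrees Finset.univ, N.β F) ∧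
      0 < N.ptdfMatrix p δ l l ∧ N.ptdfMatrix p δ l l ≤ 1) ∧
    (∀ (l : N.Line) (i j : V), (l : Sym2 V) = s(i, j) →
      N.ptdfMatrix p δ l l = N.b l * (N.Ldag i i + N.Ldag j j - 2 * N.Ldag i j) ∧
      N.ptdfMatrix p δ l l = N.b l * N.effectiveResistance i j) := by
  rw [PowerNetwork.ptdfMatrix_eq hconn hp hδ]
  refine ⟨rfl, fun l => ?_, fun l i j hl => ?_⟩
  · have hW := PowerNetwork.treeWeight_pos hconn l
    -- The trees containing l contribute `treeSum l l`; those avoiding l form the subtracted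
    -- numerator.
    have hsplit := Finset.sum_filter_add_sum_filter_not (N.spanningTrees Finset.univ)
      (fun F => l ∈ F) fun F => ∏ e ∈ F, N.b e
    rw [← PowerNetwork.treeSum_diag] at hsplit
    change _ = N.treeWeight at hsplit
    have hpos : 0 < N.treeSum l l := by
      obtain ⟨F, hF, hl⟩ := PowerNetwork.exists_mem_spanningTrees hconn l
      rw [PowerNetwork.treeSum_diag]
      exact Finset.sum_pos (fun F _ => Finset.prod_pos fun e _ => N.b_pos e)
        ⟨F, Finset.mem_filter.2 ⟨hF, hl⟩⟩
    have hnonneg : 0 ≤ ∑ F ∈ N.spanningTrees Finset.univ with l ∉ F, ∏ e ∈ F, N.b e :=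
      Finset.sum_nonneg fun F _ => Finset.prod_nonneg fun e _ => (N.b_pos e).le
    have hall : ∑ F ∈ N.spanningTrees Finset.univ, N.β F = N.treeWeight :=
      Finset.sum_congr rfl fun F hF => PowerNetwork.β_eq_prod hF
    have hdel : ∑ F ∈ N.spanningTrees (Finset.univ \ {l}), N.β F =
        ∑ F ∈ N.spanningTrees Finset.univ with l ∉ F, ∏ e ∈ F, N.b e := by
      rw [PowerNetwork.spanningTrees_sdiff_singleton]
      exact Finset.sum_congr rfl fun F hF =>
        PowerNetwork.β_eq_prod (Finset.mem_filter.1 hF).1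
    rw [PowerNetwork.B_mul_C_transpose_mul_Ldag_mul_C hconn, Matrix.smul_apply, smul_eq_mul,
      inv_mul_eq_div, hall, hdel]
    refine ⟨?_, div_pos hpos hW, (div_le_one hW).2 (by linarith)⟩
    rw [eq_sub_iff_add_eq, ← add_div, hsplit, div_self hW.ne']
  · have h : (N.B * N.Cᵀ * N.Ldag * N.C) l l = N.b l * N.effectiveResistance i j := by
      rw [PowerNetwork.B_mul_C_transpose_mul_Ldag_mul_C_diag]
      rw [← N.src_tgt l, Sym2.eq_iff] at hl
      -- The pair (i, j) may run against the orientation of l.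
      rcases hl with ⟨rfl, rfl⟩ | ⟨rfl, rfl⟩
      · rfl
      · rw [PowerNetwork.effectiveResistance_comm]
    exact ⟨by rw [h, PowerNetwork.effectiveResistance_eq], h⟩
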